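/- Let $d\in\{2,3\}$ and let $\Omega\subset\mathbb R^d$ be a bounded convex polygonal (polyhedral) domain. Let $\mathcal T_0,\mathcal T_1,\dots$ be conforming simplicial triangulations of $\Omega$, each $\mathcal T_{k+1}$ a refinement of $\mathcal T_k$, uniformly shape regular, with mesh parameters $h_k>0$ such that $h_{k+1}=h_k/2$ and $h_k$ is comparable, uniformly in $k$, to the largest diameter of the simplices of $\mathcal T_k$. Let $V_k\subset H^1_0(\Omega)$ be the $P_1$ finite element space associated with $\mathcal T_k$, and on $V_k$ and $V_k\times V_k$ let $$(v,w)_k=h_k^{d}\sum_{x}v(x)w(x),\qquad [(p,y),(q,z)]_k=(p,q)_k+(y,z)_k,$$ where $x$ runs over the interior vertices of $\mathcal T_k$. For $\beta>0$ let $\|v\|_{H^1_\beta(\Omega)}^2=\|v\|_{L_2(\Omega)}^2+\beta^{1/2}|v|_{H^1(\Omega)}^2$ and $$\mathcal B((p,y),(q,z))=\beta^{1/2}(\nabla p,\nabla q)_{L_2(\Omega)}-(y,q)_{L_2(\Omega)}-(p,z)_{L_2(\Omega)}-\beta^{1/2}(\nabla y,\nabla z)_{L_2(\Omega)},$$ and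 let $\mathfrak B_k:V_k\times V_k\to V_k\times V_k$ be the operator with $[\mathfrak B_k(p,y),(q,z)]_k=\mathcal B((p,y),(q,z))$. Let $L_k:V_k\to V_k$ be linear operators (which may depend on $\beta$), symmetric with respect to $(\cdot,\cdot)_k$, with $c_1\|v\|^2_{H^1_\beta(\Omega)}\le (L_kv,v)_k\le c_2\|v\|^2_{H^1_\beta(\Omega)}$ for all $v\in V_k$, where the constants $c_1,c_2>0$ do not depend on $k$ and $\beta$, and let $\mathfrak C_k(p,y)=(L_kp,L_ky)$. Define $$|||(p,y)|||_{s,k}=\big[(\mathfrak B_k\mathfrak C_k^{-1}\mathfrak B_k)^s(p,y),(p,y)\big]_k^{1/2}.$$ Then there is a constant $C_{\max}>0$, independent of $k$ and $\beta$, such that $$\lambda_{\max}(\mathfrak B_k\mathfrak C_k^{-1}\mathfrak B_k)\le C_{\max}(1+\beta^{1/2}h_k^{-2})\qquad\text{for all }k\ge 0,\ \beta>0 .$$ Moreover, let $C_{\max}$ be any such constant, let $C_\dagger\ge C_{\max}$, and let $R_k=\mathrm{Id}-\lambda_k\mathfrak B_k\mathfrak C_k^{-1}\mathfrak B_k$,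 where $\lambda_k=[C_\dagger(1+\beta^{1/2}h_k^{-2})]^{-1}$ if $\beta^{1/2}h_k^{-2}\ge 1$, and $\lambda_k=2/(\lambda_{\min}(\mathfrak B_k\mathfrak C_k^{-1}\mathfrak B_k)+\lambda_{\max}(\mathfrak B_k\mathfrak C_k^{-1}\mathfrak B_k))$ otherwise. Then there is a constant $C>0$, independent of $k$, $\beta$, $s$ and $m$, such that whenever $\beta^{1/2}h_k^{-2}\ge 1$, for all $0\le s\le 1$ and all integers $m\ge 1$, $$|||R_k^m(p,y)|||_{1,k}\le C\,(1+\beta^{1/2}h_k^{-2})^{s/2}\,m^{-s/2}\,|||(p,y)|||_{1-s,k}\qquad\forall\,(p,y)\in V_k\times V_k .$$ -/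

import Mathlib

open MeasureTheory

noncomputable section

namespace KKT

/-- `ℝᵈ` with its Euclidean norm. -/
abbrev Eu (d : ℕ) : Type := EuclideanSpace ℝ (Fin d)

/-- Bounded convex domain. (That `Ω` is polygonal / polyhedral is a consequence of its being
triangulated by finitely many simplices, see `IsTriangulation`.) -/
structure IsBoundedConvexDomain {d : ℕ} (Ω : Set (Eu d)) : Prop where
  isOpen : IsOpen Ω
  nonempty : Ω.Nonempty
  convex : Convex ℝ Ω
  bounded : Bornology.IsBounded Ω

/-- A (conforming) simplicial triangulation of `Ω`: a finite pure `d`-dimensional geometric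
simplicial complex whose underlying space is `closure Ω`. -/
structure IsTriangulation {d : ℕ} (Ω : Set (Eu d))
    (K : Geometry.SimplicialComplex ℝ (Eu d)) : Prop where
  finite : K.faces.Finite
  space_eq : K.space = closure Ω
  pure : ∀ s ∈ K.faces, ∃ t ∈ K.faces, s ⊆ t ∧ t.card = d + 1

/-- The diameter of the closed simplex spanned by `s`. -/
def simplexDiam {d : ℕ} (s : Finset (Eu d)) : ℝ :=
  Metric.diam (convexHull ℝ (s : Set (Eu d)))

/-- A sequence of successively refined triangulations `𝒯 0, 𝒯 1, …` of `Ω` with mesh parameters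
`h k`, where `h (k + 1) = h k / 2`, `h k` is comparable to the largest diameter of the simplices
of `𝒯 k`, and the triangulations are uniformly shape regular
(every `d`-simplex of diameter `δ` contains a closed ball of radius `δ / σ`). -/
structure MeshHierarchy {d : ℕ} (Ω : Set (Eu d)) where
  𝒯 : ℕ → Geometry.SimplicialComplex ℝ (Eu d)
  h : ℕ → ℝ
  σ : ℝ
  triangulation : ∀ k, IsTriangulation Ω (𝒯 k)
  refinement : ∀ k, ∀ s ∈ (𝒯 (k + 1)).faces, ∃ t ∈ (𝒯 k).faces,
    convexHull ℝ (s : Set (Eu d)) ⊆ convexHull ℝ (t : Set (Eu d))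
  h_pos : ∀ k, 0 < h k
  h_succ : ∀ k, h (k + 1) = h k / 2
  σ_pos : 0 < σ
  diam_le : ∀ k, ∀ s ∈ (𝒯 k).faces, simplexDiam s ≤ σ * h k
  le_diam : ∀ k, ∃ s ∈ (𝒯 k).faces, h k ≤ σ * simplexDiam s
  shape_regular : ∀ k, ∀ s ∈ (𝒯 k).faces, s.card = d + 1 →
    ∃ x, Metric.closedBall x (simplexDiam s / σ) ⊆ convexHull ℝ (s : Set (Eu d))

/-- The `P₁` finite element subspace of `H¹₀(Ω)` associated with the triangulation `K`:
continuous functions that are affine on every simplex of `K` and vanish on the boundary of `Ω`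
(the functions are extended by zero outside of `Ω`). -/
def P1Space {d : ℕ} (Ω : Set (Eu d)) (K : Geometry.SimplicialComplex ℝ (Eu d)) :
    Submodule ℝ (Eu d → ℝ) where
  carrier := {v | Continuous v ∧ (∀ x ∉ Ω, v x = 0) ∧
    ∀ s ∈ K.faces, ∃ a : Eu d →ᵃ[ℝ] ℝ, Set.EqOn v a (convexHull ℝ (s : Set (Eu d)))}
  add_mem' := by
    rintro v w ⟨hv, hv0, hva⟩ ⟨hw, hw0, hwa⟩
    refine ⟨hv.add hw, fun x hx => by simp [hv0 x hx, hw0 x hx], fun s hs => ?_⟩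
    obtain ⟨a, ha⟩ := hva s hs
    obtain ⟨b, hb⟩ := hwa s hs
    exact ⟨a + b, fun x hx => by simp [ha hx, hb hx]⟩
  zero_mem' := ⟨continuous_const, fun _ _ => rfl, fun _ _ => ⟨0, fun _ _ => rfl⟩⟩
  smul_mem' := by
    rintro c v ⟨hv, hv0, hva⟩
    refine ⟨continuous_const.mul hv, fun x hx => by simp [hv0 x hx], fun s hs => ?_⟩
    obtain ⟨a, ha⟩ := hva s hs
    exact ⟨c • a, fun x hx => by simp [ha hx]⟩

section Fractional

variable {W : Type*} [AddCommGroup W] [Module ℝ W] [FiniteDimensional ℝ W]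

/-- The finite set of the eigenvalues of an endomorphism. -/
def eigenvalues (A : Module.End ℝ W) : Finset ℝ :=
  (Module.End.finite_hasEigenvalue A).toFinset

/-- The largest eigenvalue. -/
def lamMax (A : Module.End ℝ W) : ℝ := sSup {μ : ℝ | A.HasEigenvalue μ}

/-- The smallest eigenvalue. -/
def lamMin (A : Module.End ℝ W) : ℝ := sInf {μ : ℝ | A.HasEigenvalue μ}

/-- The real power `A ^ s` of a diagonalizable endomorphism `A` with nonnegative eigenvalues,
given by the functional calculus `A ^ s = p(A)`, where the polynomial `p` interpolates
`μ ↦ μ ^ s` on the spectrum of `A`. It is the endomorphism that acts on the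
`μ`-eigenspace of `A` as multiplication by `μ ^ s`, see `fracPow_apply_of_hasEigenvector`. -/
def fracPow (A : Module.End ℝ W) (s : ℝ) : Module.End ℝ W :=
  Polynomial.aeval A (Lagrange.interpolate (eigenvalues A) id (fun μ : ℝ => μ ^ s))

theorem fracPow_apply_of_hasEigenvector (A : Module.End ℝ W) (s μ : ℝ) (x : W)
    (hx : A.HasEigenvector μ x) : fracPow A s x = μ ^ s • x := by
  have hmem : μ ∈ eigenvalues A := by
    simpa [eigenvalues] using Module.End.hasEigenvalue_of_hasEigenvector hx
  have h := Lagrange.eval_interpolate_at_node (s := eigenvalues A) (v := (id : ℝ → ℝ))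
    (fun μ : ℝ => μ ^ s) (Set.injOn_id _) hmem
  rw [fracPow, Module.End.aeval_apply_of_hasEigenvector hx]
  simp only [id] at h
  rw [h]

end Fractional

namespace MeshHierarchy

variable {d : ℕ} {Ω : Set (Eu d)} (H : MeshHierarchy Ω) (k : ℕ)

/-- The finite element space `V_k`. -/
abbrev V : Type := P1Space Ω (H.𝒯 k)

/-- The product space `V_k × V_k`. -/
abbrev VV : Type := H.V k × H.V k

theorem finite_interior_vertices : ((H.𝒯 k).vertices ∩ Ω).Finite := by
  refine Set.Finite.subset ?_ Set.inter_subset_left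
  have : Set.InjOn (fun x : Eu d => ({x} : Finset (Eu d))) (H.𝒯 k).vertices :=
    fun x _ y _ hxy => Finset.singleton_injective hxy
  refine Set.Finite.of_finite_image (((H.triangulation k).finite).subset ?_) this
  rintro _ ⟨x, hx, rfl⟩
  exact hx

/-- The set of the interior vertices of the `k`-th triangulation. -/
def interiorVertices : Finset (Eu d) := (H.finite_interior_vertices k).toFinset

/-- An element of `V_k` is determined by its values at the interior vertices. -/
theorem eq_zero_of_vertices (v : H.V k) (hv : ∀ x ∈ H.interiorVertices k, v.1 x = 0) :
    v = 0 := by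
  obtain ⟨v, hc, h0, ha⟩ := v
  apply Subtype.ext
  funext x
  change v x = 0
  by_cases hx : x ∈ Ω
  · have hx' : x ∈ (H.𝒯 k).space := by
      rw [(H.triangulation k).space_eq]; exact subset_closure hx
    obtain ⟨s, hs, hxs⟩ := Geometry.SimplicialComplex.mem_space_iff.1 hx'
    obtain ⟨a, haE⟩ := ha s hs
    have hvert : ∀ y ∈ s, a y = 0 := by
      intro y hy
      rw [← haE (subset_convexHull ℝ _ hy)]
      by_cases hyΩ : y ∈ Ω
      · refine hv y ?_
        simp only [interiorVertices, Set.Finite.mem_toFinset]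
        refine ⟨?_, hyΩ⟩
        exact (H.𝒯 k).down_closed hs (by simpa using hy) (by simp)
      · exact h0 y hyΩ
    have hconv : Convex ℝ {y : Eu d | a y = 0} := by
      have := (convex_singleton (𝕜 := ℝ) (0 : ℝ)).affine_preimage a
      simpa [Set.preimage] using this
    rw [haE hxs]
    exact convexHull_min (fun y hy => hvert y hy) hconv hxs
  · exact h0 x hx

instance finiteDimensional_V : FiniteDimensional ℝ (H.V k) := by
  let f : H.V k →ₗ[ℝ] (H.interiorVertices k → ℝ) :=
    { toFun := fun v x => v.1 x.1
      map_add' := fun _ _ => rfl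
      map_smul' := fun _ _ => rfl }
  refine FiniteDimensional.of_injective f ?_
  rw [← LinearMap.ker_eq_bot, LinearMap.ker_eq_bot']
  intro v hv
  exact H.eq_zero_of_vertices k v fun x hx => congrFun hv ⟨x, hx⟩

/-- The mesh-dependent inner product `(v, w)_k = h_k ^ d ∑_x v(x) w(x)`, the sum being over the
interior vertices. -/
def meshInner : LinearMap.BilinForm ℝ (H.V k) :=
  LinearMap.mk₂ ℝ (fun v w => H.h k ^ d * ∑ x ∈ H.interiorVertices k, v.1 x * w.1 x)
    (by intro u v w; simp [add_mul, Finset.sum_add_distrib, mul_add])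
    (by intro c v w; simp [mul_assoc, Finset.mul_sum, mul_left_comm])
    (by intro u v w; simp [mul_add, Finset.sum_add_distrib])
    (by intro c v w; simp [Finset.mul_sum, mul_left_comm])

theorem meshInner_symm (v w : H.V k) : H.meshInner k v w = H.meshInner k w v := by
  simp [meshInner, mul_comm]

theorem meshInner_self_nonneg (v : H.V k) : 0 ≤ H.meshInner k v v := by
  have := H.h_pos k
  simp only [meshInner, LinearMap.mk₂_apply]
  exact mul_nonneg (by positivity) (Finset.sum_nonneg fun x _ => mul_self_nonneg _)

theorem meshInner_self_eq_zero (v : H.V k) (hv : H.meshInner k v v = 0) : v = 0 := by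
  have hh : H.h k ^ d ≠ 0 := pow_ne_zero _ (H.h_pos k).ne'
  simp only [meshInner, LinearMap.mk₂_apply, mul_eq_zero, hh, false_or] at hv
  rw [Finset.sum_eq_zero_iff_of_nonneg fun x _ => mul_self_nonneg _] at hv
  exact H.eq_zero_of_vertices k v fun x hx => by simpa using hv x hx

/-- The mesh-dependent inner product `[(p, y), (q, z)]_k = (p, q)_k + (y, z)_k`. -/
def pairInner : LinearMap.BilinForm ℝ (H.VV k) :=
  (H.meshInner k).compl₁₂ (LinearMap.fst ℝ _ _) (LinearMap.fst ℝ _ _) +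
    (H.meshInner k).compl₁₂ (LinearMap.snd ℝ _ _) (LinearMap.snd ℝ _ _)

theorem pairInner_self_eq_zero (u : H.VV k) (hu : H.pairInner k u u = 0) : u = 0 := by
  have h1 := H.meshInner_self_nonneg k u.1
  have h2 := H.meshInner_self_nonneg k u.2
  simp only [pairInner, LinearMap.add_apply, LinearMap.compl₁₂_apply, LinearMap.fst_apply,
    LinearMap.snd_apply] at hu
  exact Prod.ext (H.meshInner_self_eq_zero k _ (by linarith))
    (H.meshInner_self_eq_zero k _ (by linarith))

theorem pairInner_nondegenerate : (H.pairInner k).Nondegenerate :=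
  ⟨fun u hu => H.pairInner_self_eq_zero k u (hu u), fun u hu => H.pairInner_self_eq_zero k u (hu u)⟩

/-- Almost every point of `Ω` is an interior point of a simplex. -/
theorem ae_mem_interior : ∀ᵐ x ∂(volume.restrict Ω), ∃ s ∈ (H.𝒯 k).faces,
    x ∈ interior (convexHull ℝ (s : Set (Eu d))) := by
  have h0 : volume (⋃ s ∈ (H.𝒯 k).faces, frontier (convexHull ℝ (s : Set (Eu d)))) = 0 :=
    (measure_biUnion_null_iff (H.triangulation k).finite.countable).2 fun s _ =>
      (convex_convexHull ℝ (s : Set (Eu d))).addHaar_frontier volume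
  have h1 : ∀ᵐ x ∂(volume : Measure (Eu d)),
      x ∉ ⋃ s ∈ (H.𝒯 k).faces, frontier (convexHull ℝ (s : Set (Eu d))) :=
    measure_eq_zero_iff_ae_notMem.1 h0
  have h2 : ∀ᵐ x ∂(volume.restrict Ω), x ∈ closure Ω :=
    ae_restrict_of_ae_restrict_of_subset subset_closure
      (ae_restrict_mem isClosed_closure.measurableSet)
  filter_upwards [ae_restrict_of_ae h1, h2] with x hx hxc
  rw [← (H.triangulation k).space_eq] at hxc
  obtain ⟨s, hs, hxs⟩ := Geometry.SimplicialComplex.mem_space_iff.1 hxc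
  refine ⟨s, hs, ?_⟩
  by_contra hxi
  exact hx (Set.mem_biUnion hs ⟨subset_closure hxs, hxi⟩)

/-- On the interior of a simplex the gradient of a finite element function is constant. -/
theorem exists_hasGradientAt (v : H.V k) (s : Finset (Eu d)) (hs : s ∈ (H.𝒯 k).faces) :
    ∃ g : Eu d, ∀ x ∈ interior (convexHull ℝ (s : Set (Eu d))), HasGradientAt v.1 g x := by
  obtain ⟨a, ha⟩ := v.2.2.2 s hs
  let A : Eu d →L[ℝ] ℝ := LinearMap.toContinuousLinearMap a.linear
  refine ⟨(InnerProductSpace.toDual ℝ (Eu d)).symm A, fun x hx => ?_⟩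
  rw [hasGradientAt_iff_hasFDerivAt, LinearIsometryEquiv.apply_symm_apply]
  have h1 : HasFDerivAt (fun y => A y + a 0) A x := A.hasFDerivAt.add_const _
  refine h1.congr_of_eventuallyEq ?_
  filter_upwards [mem_interior_iff_mem_nhds.1 hx] with y hy
  rw [ha hy]
  simpa [A] using congrFun (AffineMap.decomp a) y

theorem ae_hasGradientAt (v : H.V k) :
    ∀ᵐ x ∂(volume.restrict Ω), HasGradientAt v.1 (gradient v.1 x) x := by
  filter_upwards [H.ae_mem_interior k] with x hx
  obtain ⟨s, hs, hxs⟩ := hx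
  obtain ⟨g, hg⟩ := H.exists_hasGradientAt k v s hs
  exact (hg x hxs).differentiableAt.hasGradientAt

theorem isCompact_closure (H : MeshHierarchy Ω) : IsCompact (closure Ω) := by
  rw [← (H.triangulation 0).space_eq]
  exact (H.triangulation 0).finite.isCompact_biUnion fun s _ =>
    s.finite_toSet.isCompact_convexHull ℝ

theorem integrable_mul (v w : H.V k) :
    Integrable (fun x => v.1 x * w.1 x) (volume.restrict Ω) :=
  ((v.2.1.mul w.2.1).continuousOn.integrableOn_compact (H.isCompact_closure)).mono_set
    subset_closure

theorem integrable_grad (v w : H.V k) :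
    Integrable (fun x => inner ℝ (gradient v.1 x) (gradient w.1 x)) (volume.restrict Ω) := by
  change IntegrableOn _ Ω volume
  refine IntegrableOn.mono_set (t := ⋃ s ∈ (H.𝒯 k).faces, convexHull ℝ (s : Set (Eu d))) ?_ ?_
  · rw [integrableOn_finite_biUnion (H.triangulation k).finite]
    intro s hs
    obtain ⟨g, hg⟩ := H.exists_hasGradientAt k v s hs
    obtain ⟨g', hg'⟩ := H.exists_hasGradientAt k w s hs
    have hfin : volume (convexHull ℝ (s : Set (Eu d))) ≠ ⊤ :=
      (s.finite_toSet.isCompact_convexHull ℝ).measure_lt_top.ne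
    have hae : (interior (convexHull ℝ (s : Set (Eu d))) : Set (Eu d)) =ᵐ[volume]
        convexHull ℝ (s : Set (Eu d)) :=
      interior_ae_eq_of_null_frontier ((convex_convexHull ℝ _).addHaar_frontier volume)
    rw [← integrableOn_congr_set_ae hae]
    refine IntegrableOn.congr_fun (f := fun _ => inner ℝ g g') ?_ ?_
      isOpen_interior.measurableSet
    · exact integrableOn_const (ne_top_of_le_ne_top hfin (measure_mono interior_subset))
    · intro x hx
      simp only [(hg x hx).gradient, (hg' x hx).gradient]
  · exact subset_closure.trans (H.triangulation k).space_eq.ge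

theorem gradient_add_ae (u v : H.V k) : ∀ᵐ x ∂(volume.restrict Ω),
    gradient (u + v).1 x = gradient u.1 x + gradient v.1 x := by
  filter_upwards [H.ae_hasGradientAt k u, H.ae_hasGradientAt k v] with x hu hv
  refine HasGradientAt.gradient ?_
  rw [hasGradientAt_iff_hasFDerivAt, map_add]
  exact hu.hasFDerivAt.add hv.hasFDerivAt

theorem gradient_smul_ae (c : ℝ) (v : H.V k) : ∀ᵐ x ∂(volume.restrict Ω),
    gradient (c • v).1 x = c • gradient v.1 x := by
  filter_upwards [H.ae_hasGradientAt k v] with x hv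
  refine HasGradientAt.gradient ?_
  rw [hasGradientAt_iff_hasFDerivAt, map_smul]
  exact hv.hasFDerivAt.const_smul c

/-- The inner product `(v, w)_{L₂(Ω)}` on `V_k`. -/
def l2Inner : LinearMap.BilinForm ℝ (H.V k) :=
  LinearMap.mk₂ ℝ (fun v w => ∫ x in Ω, v.1 x * w.1 x)
    (by
      intro u v w
      rw [← integral_add (H.integrable_mul k u w) (H.integrable_mul k v w)]
      simp [add_mul])
    (by
      intro c v w
      rw [smul_eq_mul, ← integral_const_mul]
      simp [mul_assoc])
    (by
      intro u v w
      rw [← integral_add (H.integrable_mul k u v) (H.integrable_mul k u w)]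
      simp [mul_add])
    (by
      intro c v w
      rw [smul_eq_mul, ← integral_const_mul]
      simp [mul_left_comm])

/-- The bilinear form `(∇v, ∇w)_{L₂(Ω)}` on `V_k`. The elements of `V_k` are differentiable almost
everywhere in `Ω`, and `gradient` is their (weak) gradient. -/
def gradInner : LinearMap.BilinForm ℝ (H.V k) :=
  LinearMap.mk₂ ℝ (fun v w => ∫ x in Ω, inner ℝ (gradient v.1 x) (gradient w.1 x))
    (by
      intro u v w
      rw [← integral_add (H.integrable_grad k u w) (H.integrable_grad k v w)]
      refine integral_congr_ae ?_
      filter_upwards [H.gradient_add_ae k u v] with x hx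
      rw [hx, inner_add_left])
    (by
      intro c v w
      rw [smul_eq_mul, ← integral_const_mul]
      refine integral_congr_ae ?_
      filter_upwards [H.gradient_smul_ae k c v] with x hx
      rw [hx, real_inner_smul_left])
    (by
      intro u v w
      rw [← integral_add (H.integrable_grad k u v) (H.integrable_grad k u w)]
      refine integral_congr_ae ?_
      filter_upwards [H.gradient_add_ae k v w] with x hx
      rw [hx, inner_add_right])
    (by
      intro c v w
      rw [smul_eq_mul, ← integral_const_mul]
      refine integral_congr_ae ?_
      filter_upwards [H.gradient_smul_ae k c w] with x hx
      rw [hx, real_inner_smul_right])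

/-- The square of the weighted norm,
`‖v‖²_{H¹_β(Ω)} = ‖v‖²_{L₂(Ω)} + β^{1/2} |v|²_{H¹(Ω)}`, on `V_k`. -/
def normSqβ (β : ℝ) (v : H.V k) : ℝ :=
  H.l2Inner k v v + Real.sqrt β * H.gradInner k v v

/-- The bilinear form `ℬ((p,y),(q,z)) =
β^{1/2} (∇p,∇q) - (y,q) - (p,z) - β^{1/2} (∇y,∇z)` on `V_k × V_k`. -/
def formB (β : ℝ) : LinearMap.BilinForm ℝ (H.VV k) :=
  Real.sqrt β • (H.gradInner k).compl₁₂ (LinearMap.fst ℝ _ _) (LinearMap.fst ℝ _ _)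
    - (H.l2Inner k).compl₁₂ (LinearMap.snd ℝ _ _) (LinearMap.fst ℝ _ _)
    - (H.l2Inner k).compl₁₂ (LinearMap.fst ℝ _ _) (LinearMap.snd ℝ _ _)
    - Real.sqrt β • (H.gradInner k).compl₁₂ (LinearMap.snd ℝ _ _) (LinearMap.snd ℝ _ _)

/-- The operator `𝔅_k` representing `ℬ` with respect to `[·,·]_k`, see `pairInner_opB`. -/
def opB (β : ℝ) : Module.End ℝ (H.VV k) :=
  ((H.pairInner k).toDual (H.pairInner_nondegenerate k)).symm.toLinearMap ∘ₗ H.formB k β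

theorem pairInner_opB (β : ℝ) (u w : H.VV k) :
    H.pairInner k (H.opB k β u) w = H.formB k β u w :=
  LinearMap.BilinForm.apply_toDual_symm_apply (hB := H.pairInner_nondegenerate k) _ _

/-- A family of operators `L_k : V_k → V_k` (depending on `β > 0`) that are symmetric with respect
to `(·,·)_k` and satisfy `(L_k v, v)_k ≈ ‖v‖²_{H¹_β(Ω)}` uniformly in `k` and `β`. -/
structure IsPreconditioner (L : ℝ → (k : ℕ) → Module.End ℝ (H.V k)) : Prop where
  symm : ∀ β > 0, ∀ k v w, H.meshInner k (L β k v) w = H.meshInner k v (L β k w)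
  equiv : ∃ c₁ > 0, ∃ c₂ > 0, ∀ β > 0, ∀ k v,
    c₁ * H.normSqβ k β v ≤ H.meshInner k (L β k v) v ∧
      H.meshInner k (L β k v) v ≤ c₂ * H.normSqβ k β v

variable (L : ℝ → (k : ℕ) → Module.End ℝ (H.V k)) (β : ℝ)

/-- The block-diagonal operator `ℭ_k (p, y) = (L_k p, L_k y)`. -/
def opC : Module.End ℝ (H.VV k) := (L β k).prodMap (L β k)

/-- The operator `𝔅_k ℭ_k⁻¹ 𝔅_k`. (`Ring.inverse` is the inverse in the ring of endomorphisms.) -/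
def opA : Module.End ℝ (H.VV k) := H.opB k β * Ring.inverse (H.opC k L β) * H.opB k β

/-- The mesh-dependent norms `|||u|||_{s,k} = [(𝔅_k ℭ_k⁻¹ 𝔅_k)^s u, u]_k^{1/2}`. -/
def triNorm (s : ℝ) (u : H.VV k) : ℝ :=
  Real.sqrt (H.pairInner k (fracPow (H.opA k L β) s u) u)

/-- `C` is a constant `C_max`, independent of `k` and `β`, in the bound
`λ_max(𝔅_k ℭ_k⁻¹ 𝔅_k) ≤ C (1 + β^{1/2} h_k⁻²)`. -/
def IsMaxEigenvalueConstant (C : ℝ) : Prop :=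
  0 < C ∧ ∀ β > 0, ∀ k, lamMax (H.opA k L β) ≤ C * (1 + Real.sqrt β * (H.h k ^ 2)⁻¹)

open Classical in
/-- The damping factor `λ_k` (`Cdag` is the constant `C_†`). -/
def damping (Cdag : ℝ) : ℝ :=
  if Real.sqrt β * (H.h k ^ 2)⁻¹ < 1 then
    2 / (lamMin (H.opA k L β) + lamMax (H.opA k L β))
  else (Cdag * (1 + Real.sqrt β * (H.h k ^ 2)⁻¹))⁻¹

/-- The error propagation operator `R_k = Id - λ_k 𝔅_k ℭ_k⁻¹ 𝔅_k` of one post-smoothing step. -/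
def opR (Cdag : ℝ) : Module.End ℝ (H.VV k) :=
  1 - H.damping k L β Cdag • H.opA k L β

end MeshHierarchy

end KKT

end

/-! Write `A` for the operator 𝔅ℭ⁻¹𝔅. It is symmetric and nonnegative for the mesh inner product,
because 𝔅 is symmetric and ℭ is symmetric positive definite. Both claims then become statements
about its eigenvalues.

Upper bound. For w = ℭ⁻¹𝔅u, [Au, u] = ℬ(u, w) = [ℭw, w]. Young's inequality gives 2ℬ(u, w) ≤
c₁⁻¹N(u) + c₁N(w), where N is the squared weighted norm on pairs, and c₁N(w) ≤ [ℭw, w] = ℬ(u, w) is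
absorbed (`pairInner_opA_self_le`). There remains N(u) ≲ (1 + β^{1/2}h⁻²)[u, u], an inverse estimate
(`gradInner_self_le`) together with an L₂ bound (`l2Inner_self_le`). Both are proved simplex by
simplex and summed, since shape regularity lets at most σ^d simplices share a vertex
(`card_topFaces_at_le`).

Smoothing. In an orthonormal eigenbasis the estimate decouples into the scalar inequality μ(1 -
cμ)^{2m} ≤ (1/(cm))^s μ^{1-s} for 0 ≤ cμ ≤ 1 (`mul_one_sub_pow_sq_le_rpow`). The choice of damping
factor ensures cμ ≤ 1 for every eigenvalue. -/

noncomputable section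

namespace KKT

/-! ### Spectral calculus and the Richardson iteration. -/

section Spectral

variable {W : Type*} [AddCommGroup W] [Module ℝ W]

/-- An endomorphism that is symmetric with respect to an inner product `b` has a `b`-orthonormal
basis of eigenvectors. -/
theorem exists_orthonormal_eigenbasis [FiniteDimensional ℝ W]
    (b : LinearMap.BilinForm ℝ W)
    (hsymm : ∀ v w, b v w = b w v) (hnonneg : ∀ v, 0 ≤ b v v) (hdef : ∀ v, b v v = 0 → v = 0)
    (A : Module.End ℝ W) (hA : ∀ v w, b (A v) w = b v (A w)) :
    ∃ (n : ℕ) (e : Module.Basis (Fin n) ℝ W) (μ : Fin n → ℝ),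
      (∀ i j, b (e i) (e j) = if i = j then 1 else 0) ∧ ∀ i, A (e i) = μ i • e i := by
  let core : InnerProductSpace.Core ℝ W :=
    { inner := fun v w => b v w
      conj_inner_symm := fun v w => by simpa using hsymm w v
      re_inner_nonneg := fun v => by simpa using hnonneg v
      add_left := fun u v w => by simp
      smul_left := fun v w c => by simp
      definite := fun v hv => hdef v hv }
  let : NormedAddCommGroup W := core.toNormedAddCommGroup
  let : InnerProductSpace ℝ W := InnerProductSpace.ofCore core.toCore
  have hinner : ∀ v w : W, inner ℝ v w = b v w := fun _ _ => rfl
  have hS : A.IsSymmetric := fun v w => hA v w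
  refine ⟨_, (hS.eigenvectorBasis rfl).toBasis, hS.eigenvalues rfl, fun i j => ?_, fun i => ?_⟩
  · rw [← hinner]
    simp [orthonormal_iff_ite.1 (hS.eigenvectorBasis rfl).orthonormal i j]
  · simp

theorem hasEigenvalue_le_lamMax [FiniteDimensional ℝ W] (A : Module.End ℝ W)
    {μ : ℝ} (h : A.HasEigenvalue μ) :
    μ ≤ lamMax A :=
  le_csSup (Module.End.finite_hasEigenvalue A).bddAbove h

/-- By Bernoulli, (1 - t)^m (1 + mt) ≤ (1 - t²)^m ≤ 1, so mt(1 - t)^m ≤ 1. The second factor (1 -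
t)^m is at most 1. -/
theorem mul_one_sub_pow_le {t : ℝ} (ht0 : 0 ≤ t) (ht1 : t ≤ 1) {m : ℕ} (hm : 1 ≤ m) :
    t * ((1 - t) ^ m) ^ 2 ≤ (m : ℝ)⁻¹ := by
  have hm0 : (0 : ℝ) < m := by exact_mod_cast hm
  have h1 : 0 ≤ (1 - t) ^ m := pow_nonneg (by linarith) _
  have h2 : (1 - t) ^ m ≤ 1 := pow_le_one₀ (by linarith) (by linarith)
  have h3 : 1 + m * t ≤ (1 + t) ^ m := one_add_mul_le_pow (by linarith) m
  have h4 : (1 - t) ^ m * (1 + t) ^ m ≤ 1 := by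
    rw [← mul_pow]
    exact pow_le_one₀ (by nlinarith) (by nlinarith)
  have h5 : (1 - t) ^ m * (1 + m * t) ≤ 1 := (mul_le_mul_of_nonneg_left h3 h1).trans h4
  rw [← one_div, le_div_iff₀ hm0]
  have h6 : ((1 - t) ^ m) ^ 2 ≤ (1 - t) ^ m := by nlinarith
  have h7 : t * m * ((1 - t) ^ m) ^ 2 ≤ t * m * (1 - t) ^ m :=
    mul_le_mul_of_nonneg_left h6 (by positivity)
  nlinarith

/-- Interpolation between s = 0, where the damping a = (1 - cμ)^{2m} is at most 1, and s = 1, which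
is `mul_one_sub_pow_le` at t = cμ: since a ≤ a^s, μa ≤ μa^s = (μa)^s μ^{1-s}. -/
theorem mul_one_sub_pow_sq_le_rpow {c μ s : ℝ} (hc : 0 < c) (hμ : 0 ≤ μ) (hcμ : c * μ ≤ 1)
    (hs0 : 0 ≤ s) (hs1 : s ≤ 1) {m : ℕ} (hm : 1 ≤ m) :
    μ * ((1 - c * μ) ^ m) ^ 2 ≤ (c⁻¹ * (m : ℝ)⁻¹) ^ s * μ ^ (1 - s) := by
  -- The exponent law for `rpow` used below needs a positive base. At μ = 0 the left side vanishes
  -- and the right side is nonnegative, also for s = 1, where 0 ^ 0 = 1.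
  rcases hμ.eq_or_lt with rfl | hμ'
  · simp only [zero_mul]
    positivity
  have hm0 : (0 : ℝ) < m := by exact_mod_cast hm
  set a := ((1 - c * μ) ^ m) ^ 2 with ha
  have ha0 : 0 ≤ a := sq_nonneg _
  have ht0 : 0 ≤ 1 - c * μ := by linarith
  have ht1 : 1 - c * μ ≤ 1 := by nlinarith
  have ha1 : a ≤ 1 := pow_le_one₀ (pow_nonneg ht0 _) (pow_le_one₀ ht0 ht1)
  have h1 : μ * a ≤ c⁻¹ * (m : ℝ)⁻¹ := by
    have := mul_one_sub_pow_le (by positivity) hcμ hm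
    rw [← ha] at this
    calc μ * a = c⁻¹ * (c * μ * a) := by field_simp
      _ ≤ _ := by gcongr
  calc μ * a ≤ μ * a ^ s := by
        gcongr
        exact Real.self_le_rpow_of_le_one ha0 ha1 hs1
    _ = (μ * a) ^ s * μ ^ (1 - s) := by
        rw [Real.mul_rpow hμ ha0, mul_right_comm, ← Real.rpow_add hμ']
        simp
    _ ≤ _ := by gcongr

section Eigenbasis

variable {n : ℕ} {b : LinearMap.BilinForm ℝ W} {e : Module.Basis (Fin n) ℝ W}
  {μ : Fin n → ℝ} {A : Module.End ℝ W}

theorem hasEigenvector_basis (hA : ∀ i, A (e i) = μ i • e i) (i : Fin n) :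
    A.HasEigenvector (μ i) (e i) :=
  ⟨Module.End.mem_eigenspace_iff.2 (hA i), e.ne_zero i⟩

theorem form_fracPow_self [FiniteDimensional ℝ W]
    (hb : ∀ i j, b (e i) (e j) = if i = j then 1 else 0)
    (hA : ∀ i, A (e i) = μ i • e i) (s : ℝ) (u : W) :
    b (fracPow A s u) u = ∑ i, μ i ^ s * e.repr u i ^ 2 := by
  have h1 : fracPow A s u = ∑ i, (e.repr u i * μ i ^ s) • e i := by
    conv_lhs => rw [← e.sum_repr u]
    simp only [map_sum, map_smul, smul_smul, fracPow_apply_of_hasEigenvector A s _ _ (hasEigenvector_basis hA _)]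
  have h2 : ∀ i, b (e i) u = e.repr u i := fun i => by
    conv_lhs => rw [← e.sum_repr u]
    simp only [map_sum, map_smul, hb, smul_eq_mul]
    simp
  simp only [h1, map_sum, LinearMap.sum_apply, map_smul, LinearMap.smul_apply, h2, smul_eq_mul]
  exact Finset.sum_congr rfl fun i _ => by ring

theorem repr_one_sub_smul_pow (hA : ∀ i, A (e i) = μ i • e i) (c : ℝ) (m : ℕ) (u : W)
    (i : Fin n) : e.repr (((1 - c • A) ^ m) u) i = (1 - c * μ i) ^ m * e.repr u i := by
  have h1 : ∀ j, ((1 - c • A) ^ m) (e j) = (1 - c * μ j) ^ m • e j := fun j => by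
    induction m with
    | zero => simp
    | succ m ih =>
      rw [pow_succ', Module.End.mul_apply, ih]
      simp only [map_smul, LinearMap.sub_apply, Module.End.one_apply, LinearMap.smul_apply, hA]
      module
  conv_lhs => rw [← e.sum_repr u]
  simp only [map_sum, map_smul, h1, Finsupp.coe_finsetSum, Finset.sum_apply, Finsupp.smul_apply,
    e.repr_self, smul_eq_mul]
  rw [Finset.sum_eq_single i]
  · simp [mul_comm]
  · intro j _ hj
    simp [hj]
  · simp

end Eigenbasis

/-- The smoothing property of the Richardson iteration with a symmetric nonnegative operator. -/
theorem sqrt_fracPow_richardson_le [FiniteDimensional ℝ W]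
    (b : LinearMap.BilinForm ℝ W)
    (hsymm : ∀ v w, b v w = b w v) (hnonneg : ∀ v, 0 ≤ b v v) (hdef : ∀ v, b v v = 0 → v = 0)
    (A : Module.End ℝ W) (hA : ∀ v w, b (A v) w = b v (A w)) (hA0 : ∀ v, 0 ≤ b (A v) v)
    {c : ℝ} (hc : 0 < c) (hcA : c * lamMax A ≤ 1) {s : ℝ} (hs0 : 0 ≤ s) (hs1 : s ≤ 1)
    {m : ℕ} (hm : 1 ≤ m) (u : W) :
    Real.sqrt (b (fracPow A 1 (((1 - c • A) ^ m) u)) (((1 - c • A) ^ m) u)) ≤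
      c⁻¹ ^ (s / 2) * (m : ℝ) ^ (-s / 2) * Real.sqrt (b (fracPow A (1 - s) u) u) := by
  obtain ⟨n, e, μ, hb, he⟩ := exists_orthonormal_eigenbasis b hsymm hnonneg hdef A hA
  have hμ0 : ∀ i, 0 ≤ μ i := fun i => by simpa [he, hb] using hA0 (e i)
  have hμ1 : ∀ i, c * μ i ≤ 1 := fun i =>
    (mul_le_mul_of_nonneg_left (hasEigenvalue_le_lamMax A
      (Module.End.hasEigenvalue_of_hasEigenvector (hasEigenvector_basis he i))) hc.le).trans hcA
  have hm0 : (0 : ℝ) < m := by exact_mod_cast hm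
  rw [form_fracPow_self hb he, form_fracPow_self hb he]
  -- With the constant moved under the square root, the claim is a termwise comparison of two
  -- spectral sums.
  have hfac : c⁻¹ ^ (s / 2) * (m : ℝ) ^ (-s / 2) = Real.sqrt ((c⁻¹ * (m : ℝ)⁻¹) ^ s) := by
    rw [Real.sqrt_eq_rpow, ← Real.rpow_mul (by positivity),
      Real.mul_rpow (by positivity) (by positivity), Real.inv_rpow hm0.le, ← Real.rpow_neg hm0.le]
    congr 2 <;> ring
  rw [hfac, ← Real.sqrt_mul (by positivity), Finset.mul_sum]
  refine Real.sqrt_le_sqrt (Finset.sum_le_sum fun i _ => ?_)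
  rw [repr_one_sub_smul_pow he, Real.rpow_one, mul_pow, ← mul_assoc, ← mul_assoc]
  exact mul_le_mul_of_nonneg_right
    (mul_one_sub_pow_sq_le_rpow hc (hμ0 i) (hμ1 i) hs0 hs1 hm) (sq_nonneg _)

theorem lamMax_le (b : LinearMap.BilinForm ℝ W) (hnonneg : ∀ v, 0 ≤ b v v)
    (hdef : ∀ v, b v v = 0 → v = 0) (A : Module.End ℝ W) {M : ℝ} (hM : 0 ≤ M)
    (hA : ∀ v, b (A v) v ≤ M * b v v) : lamMax A ≤ M := by
  -- The set of eigenvalues is empty when the space is trivial; its `sSup` is then 0, whence the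
  -- need for 0 ≤ M.
  refine Real.sSup_le (fun μ hμ => ?_) hM
  obtain ⟨v, hv⟩ := Module.End.HasEigenvalue.exists_hasEigenvector hμ
  have hpos : 0 < b v v := (hnonneg v).lt_of_ne fun h => hv.2 (hdef v h.symm)
  have h := hA v
  rw [hv.apply_eq_smul, map_smul, LinearMap.smul_apply, smul_eq_mul] at h
  exact le_of_mul_le_mul_right h hpos

end Spectral

/-! ### Geometry of simplices. -/

section Simplices

variable {d : ℕ}

theorem isBounded_hull (s : Finset (Eu d)) :
    Bornology.IsBounded (convexHull ℝ (s : Set (Eu d))) :=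
  (s.finite_toSet.isCompact_convexHull ℝ).isBounded

theorem measurableSet_hull (s : Finset (Eu d)) :
    MeasurableSet (convexHull ℝ (s : Set (Eu d))) :=
  (s.finite_toSet.isCompact_convexHull ℝ).measurableSet

theorem volume_hull_ne_top (s : Finset (Eu d)) :
    volume (convexHull ℝ (s : Set (Eu d))) ≠ ⊤ :=
  (s.finite_toSet.isCompact_convexHull ℝ).measure_lt_top.ne

theorem dist_le_simplexDiam {s : Finset (Eu d)} {x y : Eu d}
    (hx : x ∈ convexHull ℝ (s : Set (Eu d))) (hy : y ∈ convexHull ℝ (s : Set (Eu d))) :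
    dist x y ≤ simplexDiam s :=
  Metric.dist_le_diam_of_mem (isBounded_hull s) hx hy

theorem simplexDiam_nonneg (s : Finset (Eu d)) : 0 ≤ simplexDiam s := Metric.diam_nonneg

theorem simplexDiam_pos {s : Finset (Eu d)} (hs : 1 < s.card) : 0 < simplexDiam s := by
  obtain ⟨x, hx, y, hy, hxy⟩ := Finset.one_lt_card.1 hs
  exact (dist_pos.2 hxy).trans_le
    (dist_le_simplexDiam (subset_convexHull ℝ _ hx) (subset_convexHull ℝ _ hy))

/-- The volume of the unit ball of `ℝᵈ`. -/
def ballVol (d : ℕ) : ℝ := volume.real (Metric.ball (0 : Eu d) 1)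

theorem ballVol_pos (d : ℕ) : 0 < ballVol d :=
  ENNReal.toReal_pos (Metric.measure_ball_pos volume _ one_pos).ne' measure_ball_lt_top.ne

theorem volume_real_closedBall (x : Eu d) {r : ℝ} (hr : 0 ≤ r) :
    volume.real (Metric.closedBall x r) = r ^ d * ballVol d := by
  rw [Measure.real, Measure.addHaar_closedBall volume x hr, ENNReal.toReal_mul,
    ENNReal.toReal_ofReal (by positivity), finrank_euclideanSpace_fin]
  rfl

theorem volume_real_hull_le {s : Finset (Eu d)} (hs : s.Nonempty) :
    volume.real (convexHull ℝ (s : Set (Eu d))) ≤ simplexDiam s ^ d * ballVol d := by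
  obtain ⟨x, hx⟩ := hs
  rw [← volume_real_closedBall x (simplexDiam_nonneg s)]
  exact measureReal_mono
    (fun y hy => dist_le_simplexDiam hy (subset_convexHull ℝ _ hx)) measure_closedBall_lt_top.ne

/-- The gradient of an affine function on a set that contains a ball is bounded by the maximum of
the function divided by the radius. -/
theorem norm_le_of_affine_bound {a : Eu d →ᵃ[ℝ] ℝ} {g z : Eu d} {r M : ℝ} (hr : 0 ≤ r)
    (hg : ∀ x, a.linear x = inner ℝ g x) (ha : ∀ x ∈ Metric.closedBall z r, |a x| ≤ M) :
    r * ‖g‖ ≤ M := by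
  rcases eq_or_ne g 0 with rfl | hg0
  · simpa using (abs_nonneg _).trans (ha z (Metric.mem_closedBall_self hr))
  have hn : ‖g‖ ≠ 0 := norm_ne_zero_iff.2 hg0
  -- The points z ± w lie on the sphere of radius r along the gradient, so the values of `a` there
  -- differ by 2r‖g‖, while both are bounded by M.
  set w : Eu d := (r / ‖g‖) • g with hw
  have hwn : ‖w‖ = r := by
    rw [hw, norm_smul, Real.norm_of_nonneg (by positivity)]
    field_simp
  have hp := ha (w +ᵥ z) (by simp [hwn])
  have hm := ha (-w +ᵥ z) (by simp [hwn])
  rw [AffineMap.map_vadd, hg] at hp hm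
  have hi : inner ℝ g w = r * ‖g‖ := by
    rw [hw, real_inner_smul_right, real_inner_self_eq_norm_sq]
    field_simp
  simp only [inner_neg_right, hi, vadd_eq_add] at hp hm
  have h1 := (abs_le.1 hp).2
  have h2 := (abs_le.1 hm).1
  linarith

/-- A function that is affine on a simplex is bounded by its values at the vertices. -/
theorem abs_affine_le {s : Finset (Eu d)} (a : Eu d →ᵃ[ℝ] ℝ) {M : ℝ} (hM : ∀ y ∈ s, |a y| ≤ M)
    {x : Eu d} (hx : x ∈ convexHull ℝ (s : Set (Eu d))) : |a x| ≤ M := by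
  have hconv : Convex ℝ {y : Eu d | a y ∈ Set.Icc (-M) M} := (convex_Icc (-M) M).affine_preimage a
  exact abs_le.2 (convexHull_min (fun y hy => abs_le.1 (hM y hy)) hconv hx)

/-- A ball inside a bounded convex set, scaled towards a point of the set. -/
theorem closedBall_scaled_subset {S : Set (Eu d)} (hS : Convex ℝ S) {x z : Eu d} (hx : x ∈ S)
    {δ ρ t : ℝ} (hz : Metric.closedBall z ρ ⊆ S) (hδ : ∀ y ∈ S, dist y x ≤ δ)
    (ht0 : 0 < t) (ht1 : t ≤ 1) :
    Metric.closedBall (x + t • (z - x)) (t * ρ) ⊆ S ∩ Metric.closedBall x (t * δ) := by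
  intro y hy
  -- The preimage of y under the homothety with centre x and ratio t, which maps the ball around z
  -- onto the scaled ball.
  set w : Eu d := x + t⁻¹ • (y - x) with hw
  have hyw : y - x = t • (w - x) := by
    rw [hw, add_sub_cancel_left, smul_smul, mul_inv_cancel₀ ht0.ne', one_smul]
  have hyw' : y = x + t • (w - x) := by rw [← hyw]; abel
  have hwS : w ∈ S := by
    refine hz ?_
    rw [Metric.mem_closedBall, dist_eq_norm] at hy ⊢
    have : y - (x + t • (z - x)) = t • (w - z) := by rw [hyw']; module
    rw [this, norm_smul, Real.norm_of_nonneg ht0.le] at hy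
    exact le_of_mul_le_mul_left hy ht0
  refine ⟨?_, ?_⟩
  · rw [hyw']
    exact hS.add_smul_sub_mem hx hwS ⟨ht0.le, ht1⟩
  · rw [Metric.mem_closedBall, dist_eq_norm, hyw, norm_smul, Real.norm_of_nonneg ht0.le,
      ← dist_eq_norm]
    exact mul_le_mul_of_nonneg_left (hδ w hwS) ht0.le

/-- Two different full-dimensional simplices of a complex overlap in a null set. -/
theorem aedisjoint_hull {K : Geometry.SimplicialComplex ℝ (Eu d)} {s t : Finset (Eu d)}
    (hs : s ∈ K.faces) (ht : t ∈ K.faces) (hc : s.card = t.card) (hst : s ≠ t) :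
    AEDisjoint volume (convexHull ℝ (s : Set (Eu d))) (convexHull ℝ (t : Set (Eu d))) := by
  -- The overlap is contained in the hull of the common vertices. By affine independence of s, the
  -- vertex p is not in their affine span, so that span is a proper subspace and a null set.
  obtain ⟨p, hps, hpt⟩ : ∃ p ∈ s, p ∉ t := by
    by_contra! h
    exact hst (Finset.eq_of_subset_of_card_le h hc.ge)
  have hne : affineSpan ℝ ((s : Set (Eu d)) ∩ t) ≠ ⊤ := by
    intro htop
    have h1 : p ∈ affineSpan ℝ ((s : Set (Eu d)) ∩ t) := by rw [htop]; trivial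
    have h2 := (K.indep hs).mem_affineSpan_iff ⟨p, hps⟩ {q | (q : Eu d) ∈ t}
    have h3 : ((↑) : s → Eu d) '' {q | (q : Eu d) ∈ t} = (s : Set (Eu d)) ∩ t := by
      ext q
      simp [and_comm]
    rw [h3] at h2
    exact hpt (h2.1 h1)
  refine measure_mono_null ((K.inter_subset_convexHull hs ht).trans ?_)
    (Measure.addHaar_affineSubspace volume _ hne)
  exact convexHull_subset_affineSpan _

end Simplices

/-! ### Bounding an integral by a sum over a cover. -/

section Integral

variable {α : Type*} [MeasurableSpace α] {ν : Measure α}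

/-- A function that is bounded by a constant on each of finitely many sets covering almost
everything. -/
theorem setIntegral_le_sum {ι : Type*} (F : Finset ι) (T : ι → Set α) (M : ι → ℝ) {Ω : Set α}
    {f : α → ℝ} (hT : ∀ i ∈ F, MeasurableSet (T i)) (hfin : ∀ i ∈ F, ν (T i) ≠ ⊤)
    (hM : ∀ i ∈ F, 0 ≤ M i) (hf : IntegrableOn f Ω ν)
    (h : ∀ᵐ x ∂(ν.restrict Ω), ∃ i ∈ F, x ∈ T i ∧ f x ≤ M i) :
    ∫ x in Ω, f x ∂ν ≤ ∑ i ∈ F, M i * ν.real (T i) := by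
  have hint : ∀ i ∈ F, Integrable ((T i).indicator fun _ => M i) (ν.restrict Ω) := fun i hi =>
    ((integrable_indicator_iff (hT i hi)).2 (integrableOn_const (hfin i hi))).restrict
  -- The sets may overlap: as every M i is nonnegative, the sum of the indicators still dominates f.
  calc ∫ x in Ω, f x ∂ν ≤ ∫ x in Ω, ∑ i ∈ F, (T i).indicator (fun _ => M i) x ∂ν := by
        refine integral_mono_ae hf (integrable_finsetSum _ hint) ?_
        filter_upwards [h] with x hx
        obtain ⟨i, hi, hxi, hle⟩ := hx
        refine hle.trans ?_
        have := Finset.single_le_sum (f := fun j => (T j).indicator (fun _ => M j) x)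
          (fun j hj => Set.indicator_nonneg (fun _ _ => hM j hj) x) hi
        simpa [hxi] using this
    _ = ∑ i ∈ F, ∫ x in Ω, (T i).indicator (fun _ => M i) x ∂ν := integral_finsetSum _ hint
    _ ≤ ∑ i ∈ F, M i * ν.real (T i) := by
        refine Finset.sum_le_sum fun i hi => ?_
        rw [setIntegral_indicator (hT i hi), setIntegral_const, smul_eq_mul, mul_comm]
        exact mul_le_mul_of_nonneg_left (measureReal_mono Set.inter_subset_right (hfin i hi))
          (hM i hi)

end Integral

/-! ### Inverse estimates in the mesh-dependent norm. -/

namespace MeshHierarchy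

variable {d : ℕ} {Ω : Set (Eu d)} (H : MeshHierarchy Ω) (k : ℕ)

/-- The set of the `d`-dimensional simplices of the `k`-th triangulation. -/
def topFaces : Finset (Finset (Eu d)) :=
  {s ∈ (H.triangulation k).finite.toFinset | s.card = d + 1}

variable {k} in
theorem mem_topFaces {s : Finset (Eu d)} :
    s ∈ H.topFaces k ↔ s ∈ (H.𝒯 k).faces ∧ s.card = d + 1 := by
  simp [topFaces]

theorem simplexDiam_topFace_pos (hd : 0 < d) {s : Finset (Eu d)} (hs : s ∈ H.topFaces k) :
    0 < simplexDiam s :=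
  simplexDiam_pos (by rw [((H.mem_topFaces).1 hs).2]; omega)

/-- By shape regularity, a bounded number of simplices meet at a point. -/
theorem card_topFaces_at_le (hd : 0 < d) (x : Eu d) :
    (({s ∈ H.topFaces k | x ∈ s} : Finset (Finset (Eu d))).card : ℝ) ≤ H.σ ^ d := by
  have hσ := H.σ_pos
  set F : Finset (Finset (Eu d)) := {s ∈ H.topFaces k | x ∈ s} with hF
  rcases F.eq_empty_or_nonempty with h0 | hne
  · rw [h0]
    simp only [Finset.card_empty, Nat.cast_zero]
    positivity
  have hFt : ∀ s ∈ F, s ∈ H.topFaces k ∧ x ∈ s := fun s hs => by simpa [hF] using hs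
  -- Packing argument: each simplex at x, shrunk towards x to the smallest diameter r, still
  -- contains a ball of radius r / σ. These balls are almost disjoint and lie in the ball of radius
  -- r around x, so comparing volumes bounds their number by σ^d.
  obtain ⟨s₀, hs₀, hmin⟩ := F.exists_min_image simplexDiam hne
  set r := simplexDiam s₀ with hr
  have hr0 : 0 < r := H.simplexDiam_topFace_pos k hd (hFt s₀ hs₀).1
  have hball : ∀ s ∈ F, ∃ c, Metric.closedBall c (r / H.σ) ⊆
      convexHull ℝ (s : Set (Eu d)) ∩ Metric.closedBall x r := by
    intro s hs
    obtain ⟨hst, hxs⟩ := hFt s hs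
    have hδ := H.simplexDiam_topFace_pos k hd hst
    obtain ⟨z, hz⟩ := H.shape_regular k s (H.mem_topFaces.1 hst).1 (H.mem_topFaces.1 hst).2
    have hxh := subset_convexHull ℝ (s : Set (Eu d)) hxs
    have h := closedBall_scaled_subset (convex_convexHull ℝ _) hxh hz
      (fun y hy => dist_le_simplexDiam hy hxh) (div_pos hr0 hδ) ((div_le_one hδ).2 (hmin s hs))
    have e1 : r / simplexDiam s * (simplexDiam s / H.σ) = r / H.σ := by field_simp
    have e2 : r / simplexDiam s * simplexDiam s = r := by field_simp
    rw [e1, e2] at h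
    exact ⟨_, h⟩
  choose! c hc using hball
  have hdisj : (F : Set (Finset (Eu d))).Pairwise
      (Function.onFun (AEDisjoint volume) fun s => Metric.closedBall (c s) (r / H.σ)) := by
    intro s hs t ht hst
    have hs' := H.mem_topFaces.1 (hFt s hs).1
    have ht' := H.mem_topFaces.1 (hFt t ht).1
    exact (aedisjoint_hull hs'.1 ht'.1 (hs'.2.trans ht'.2.symm) hst).mono
      ((hc s hs).trans Set.inter_subset_left) ((hc t ht).trans Set.inter_subset_left)
  have hsum := measureReal_biUnion_finset₀ hdisj
    (fun s _ => measurableSet_closedBall.nullMeasurableSet)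
    (fun s _ => measure_closedBall_lt_top.ne)
  have hle : volume.real (⋃ s ∈ F, Metric.closedBall (c s) (r / H.σ)) ≤
      volume.real (Metric.closedBall x r) :=
    measureReal_mono (Set.iUnion₂_subset fun s hs => (hc s hs).trans Set.inter_subset_right)
      measure_closedBall_lt_top.ne
  rw [hsum, volume_real_closedBall x hr0.le, Finset.sum_congr rfl fun s _ =>
    volume_real_closedBall (c s) (by positivity : 0 ≤ r / H.σ), Finset.sum_const, nsmul_eq_mul,
    div_pow] at hle
  have hκ := ballVol_pos d
  have hrd : 0 < r ^ d * ballVol d := by positivity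
  have e : (F.card : ℝ) * (r ^ d / H.σ ^ d * ballVol d) =
      F.card / H.σ ^ d * (r ^ d * ballVol d) := by ring
  rw [e] at hle
  have h2 := (mul_le_iff_le_one_left hrd).1 hle
  rwa [div_le_one (by positivity)] at h2

/-- The sum of the squares of the values of `v` at the vertices of `s`. -/
def vertexSq (v : Eu d → ℝ) (s : Finset (Eu d)) : ℝ := ∑ x ∈ s, v x ^ 2

theorem vertexSq_nonneg (v : Eu d → ℝ) (s : Finset (Eu d)) : 0 ≤ vertexSq v s :=
  Finset.sum_nonneg fun _ _ => sq_nonneg _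

theorem abs_le_sqrt_vertexSq (v : Eu d → ℝ) {s : Finset (Eu d)} {y : Eu d} (hy : y ∈ s) :
    |v y| ≤ Real.sqrt (vertexSq v s) :=
  Real.abs_le_sqrt (Finset.single_le_sum (f := fun x => v x ^ 2) (fun _ _ => sq_nonneg _) hy)

theorem mem_interiorVertices {x : Eu d} {s : Finset (Eu d)} (hs : s ∈ (H.𝒯 k).faces)
    (hx : x ∈ s) (hxΩ : x ∈ Ω) : x ∈ H.interiorVertices k := by
  simp only [interiorVertices, Set.Finite.mem_toFinset]
  exact ⟨(H.𝒯 k).down_closed hs (by simpa using hx) (by simp), hxΩ⟩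

/-- Double counting: after exchanging the sums, each interior vertex occurs once for every simplex
containing it, at most σ^d times. Boundary vertices contribute nothing because v vanishes there. -/
theorem sum_vertexSq_le (hd : 0 < d) (v : H.V k) :
    ∑ s ∈ H.topFaces k, vertexSq v.1 s ≤
      H.σ ^ d * ∑ x ∈ H.interiorVertices k, v.1 x ^ 2 := by
  classical
  have h1 : ∀ s ∈ H.topFaces k, vertexSq v.1 s =
      ∑ x ∈ H.interiorVertices k, if x ∈ s then v.1 x ^ 2 else 0 := by
    intro s hs
    rw [← Finset.sum_filter, vertexSq]
    symm
    refine Finset.sum_subset (fun x hx => (Finset.mem_filter.1 hx).2) fun x hx hx' => ?_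
    have hxΩ : x ∉ Ω := fun hxΩ => hx' (Finset.mem_filter.2
      ⟨H.mem_interiorVertices k (H.mem_topFaces.1 hs).1 hx hxΩ, hx⟩)
    rw [v.2.2.1 x hxΩ]
    simp
  rw [Finset.sum_congr rfl h1, Finset.sum_comm, Finset.mul_sum]
  refine Finset.sum_le_sum fun x _ => ?_
  rw [← Finset.sum_filter, Finset.sum_const, nsmul_eq_mul]
  exact mul_le_mul_of_nonneg_right (H.card_topFaces_at_le k hd x) (sq_nonneg _)

theorem ae_mem_topFace : ∀ᵐ x ∂(volume.restrict Ω), ∃ s ∈ H.topFaces k,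
    x ∈ interior (convexHull ℝ (s : Set (Eu d))) := by
  filter_upwards [H.ae_mem_interior k] with x hx
  obtain ⟨s, hs, hxs⟩ := hx
  obtain ⟨t, ht, hst, hc⟩ := (H.triangulation k).pure s hs
  exact ⟨t, H.mem_topFaces.2 ⟨ht, hc⟩,
    interior_mono (convexHull_mono (Finset.coe_subset.2 hst)) hxs⟩

theorem abs_le_of_mem_hull (v : H.V k) {s : Finset (Eu d)} (hs : s ∈ (H.𝒯 k).faces) {x : Eu d}
    (hx : x ∈ convexHull ℝ (s : Set (Eu d))) : |v.1 x| ≤ Real.sqrt (vertexSq v.1 s) := by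
  obtain ⟨a, ha⟩ := v.2.2.2 s hs
  rw [ha hx]
  refine abs_affine_le a (fun y hy => ?_) hx
  rw [← ha (subset_convexHull ℝ _ hy)]
  exact abs_le_sqrt_vertexSq _ hy

/-- The local inverse estimate: on the inscribed ball of radius diam / σ, the affine function is
bounded by its vertex values, which controls its slope. -/
theorem norm_gradient_le (v : H.V k) {s : Finset (Eu d)} (hs : s ∈ H.topFaces k) {x : Eu d}
    (hx : x ∈ interior (convexHull ℝ (s : Set (Eu d)))) :
    simplexDiam s / H.σ * ‖gradient v.1 x‖ ≤ Real.sqrt (vertexSq v.1 s) := by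
  obtain ⟨hsf, hsc⟩ := H.mem_topFaces.1 hs
  obtain ⟨a, ha⟩ := v.2.2.2 s hsf
  obtain ⟨z, hz⟩ := H.shape_regular k s hsf hsc
  let A : Eu d →L[ℝ] ℝ := LinearMap.toContinuousLinearMap a.linear
  have hgrad : HasGradientAt v.1 ((InnerProductSpace.toDual ℝ (Eu d)).symm A) x := by
    rw [hasGradientAt_iff_hasFDerivAt, LinearIsometryEquiv.apply_symm_apply]
    refine (A.hasFDerivAt.add_const (a 0)).congr_of_eventuallyEq ?_
    filter_upwards [mem_interior_iff_mem_nhds.1 hx] with y hy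
    rw [ha hy]
    simpa [A] using congrFun (AffineMap.decomp a) y
  rw [hgrad.gradient]
  refine norm_le_of_affine_bound (a := a) (z := z)
    (div_nonneg (simplexDiam_nonneg s) H.σ_pos.le) (fun y => ?_) fun y hy => ?_
  · rw [InnerProductSpace.toDual_symm_apply]
    rfl
  · rw [← ha (hz hy)]
    exact H.abs_le_of_mem_hull k v hsf (hz hy)

/-- The constant in the comparison of the norms with the mesh-dependent norm. -/
def meshConst : ℝ := ballVol d * H.σ ^ d * H.σ ^ d

theorem meshConst_pos : 0 < H.meshConst := by
  have := ballVol_pos d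
  have := H.σ_pos
  unfold meshConst
  positivity

theorem meshInner_self (v : H.V k) :
    H.meshInner k v v = H.h k ^ d * ∑ x ∈ H.interiorVertices k, v.1 x ^ 2 := by
  simp [meshInner, sq]

/-- In `meshConst`, one factor σ^d comes from diam ≤ σh in the volume bound, the other from counting
the simplices at a vertex. -/
theorem l2Inner_self_le (hd : 0 < d) (v : H.V k) :
    H.l2Inner k v v ≤ H.meshConst * H.meshInner k v v := by
  have hκ := ballVol_pos d
  have hσ := H.σ_pos
  have hh := H.h_pos k
  calc H.l2Inner k v v = ∫ x in Ω, v.1 x * v.1 x := rfl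
    _ ≤ ∑ s ∈ H.topFaces k, vertexSq v.1 s * volume.real (convexHull ℝ (s : Set (Eu d))) := by
        refine setIntegral_le_sum _ (fun s : Finset (Eu d) => convexHull ℝ (s : Set (Eu d))) _
          (fun s _ => measurableSet_hull s) (fun s _ => volume_hull_ne_top s)
          (fun s _ => vertexSq_nonneg _ s) (H.integrable_mul k v v) ?_
        filter_upwards [H.ae_mem_topFace k] with x hx
        obtain ⟨s, hs, hxs⟩ := hx
        have hxs' := interior_subset hxs
        refine ⟨s, hs, hxs', ?_⟩
        have h := H.abs_le_of_mem_hull k v (H.mem_topFaces.1 hs).1 hxs'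
        rw [← abs_mul_abs_self, ← Real.mul_self_sqrt (vertexSq_nonneg v.1 s)]
        exact mul_self_le_mul_self (abs_nonneg _) h
    _ ≤ ∑ s ∈ H.topFaces k, vertexSq v.1 s * ((H.σ * H.h k) ^ d * ballVol d) := by
        refine Finset.sum_le_sum fun s hs => mul_le_mul_of_nonneg_left ?_ (vertexSq_nonneg _ s)
        have hsf := (H.mem_topFaces.1 hs).1
        refine (volume_real_hull_le ((H.𝒯 k).nonempty_of_mem_faces hsf)).trans ?_
        gcongr
        · exact simplexDiam_nonneg s
        · exact H.diam_le k s hsf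
    _ = (∑ s ∈ H.topFaces k, vertexSq v.1 s) * ((H.σ * H.h k) ^ d * ballVol d) :=
        (Finset.sum_mul ..).symm
    _ ≤ (H.σ ^ d * ∑ x ∈ H.interiorVertices k, v.1 x ^ 2) *
          ((H.σ * H.h k) ^ d * ballVol d) :=
        mul_le_mul_of_nonneg_right (H.sum_vertexSq_le k hd v) (by positivity)
    _ = H.meshConst * H.meshInner k v v := by
        rw [meshInner_self, meshConst]
        ring

/-- The inverse estimate with respect to the mesh-dependent norm. -/
theorem gradInner_self_le (hd : 2 ≤ d) (v : H.V k) :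
    H.gradInner k v v ≤ H.meshConst * (H.h k ^ 2)⁻¹ * H.meshInner k v v := by
  have hκ := ballVol_pos d
  have hσ := H.σ_pos
  have hh := H.h_pos k
  -- Volume over squared diameter leaves diam^(d - 2). As d ≥ 2 this is bounded above through diam ≤
  -- σh, so no lower bound on individual diameters is required.
  obtain ⟨j, rfl⟩ : ∃ j, d = j + 2 := ⟨d - 2, by omega⟩
  have hpos : ∀ s ∈ H.topFaces k, 0 < simplexDiam s := fun s hs =>
    H.simplexDiam_topFace_pos k (by omega) hs
  calc H.gradInner k v v = ∫ x in Ω, inner ℝ (gradient v.1 x) (gradient v.1 x) := rfl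
    _ ≤ ∑ s ∈ H.topFaces k, vertexSq v.1 s / (simplexDiam s / H.σ) ^ 2 *
          volume.real (convexHull ℝ (s : Set (Eu (j + 2)))) := by
        refine setIntegral_le_sum _ (fun s : Finset (Eu (j + 2)) => convexHull ℝ (s : Set (Eu (j + 2)))) _
          (fun s _ => measurableSet_hull s) (fun s _ => volume_hull_ne_top s)
          (fun s _ => div_nonneg (vertexSq_nonneg _ s) (sq_nonneg _)) (H.integrable_grad k v v) ?_
        filter_upwards [H.ae_mem_topFace k] with x hx
        obtain ⟨s, hs, hxs⟩ := hx
        refine ⟨s, hs, interior_subset hxs, ?_⟩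
        have hδ := hpos s hs
        have h := H.norm_gradient_le k v hs hxs
        rw [real_inner_self_eq_norm_sq, le_div_iff₀ (by positivity), mul_comm, ← mul_pow,
          ← Real.sq_sqrt (vertexSq_nonneg v.1 s)]
        exact pow_le_pow_left₀ (by positivity) h 2
    _ ≤ ∑ s ∈ H.topFaces k, vertexSq v.1 s * (H.σ ^ 2 * (H.σ * H.h k) ^ j * ballVol (j + 2)) := by
        refine Finset.sum_le_sum fun s hs => ?_
        have hsf := (H.mem_topFaces.1 hs).1
        have hδ := hpos s hs
        have hv := vertexSq_nonneg v.1 s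
        calc _ ≤ vertexSq v.1 s / (simplexDiam s / H.σ) ^ 2 *
              (simplexDiam s ^ (j + 2) * ballVol (j + 2)) := by
              gcongr
              exact volume_real_hull_le ((H.𝒯 k).nonempty_of_mem_faces hsf)
          _ = vertexSq v.1 s * (H.σ ^ 2 * simplexDiam s ^ j * ballVol (j + 2)) := by
              field_simp
              ring
          _ ≤ _ := by
              gcongr
              exact H.diam_le k s hsf
    _ = (∑ s ∈ H.topFaces k, vertexSq v.1 s) *
          (H.σ ^ 2 * (H.σ * H.h k) ^ j * ballVol (j + 2)) := (Finset.sum_mul ..).symm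
    _ ≤ (H.σ ^ (j + 2) * ∑ x ∈ H.interiorVertices k, v.1 x ^ 2) *
          (H.σ ^ 2 * (H.σ * H.h k) ^ j * ballVol (j + 2)) :=
        mul_le_mul_of_nonneg_right (H.sum_vertexSq_le k (by omega) v) (by positivity)
    _ = H.meshConst * (H.h k ^ 2)⁻¹ * H.meshInner k v v := by
        rw [meshInner_self, meshConst]
        field_simp
        ring

theorem normSqβ_le (hd : 2 ≤ d) (β : ℝ) (v : H.V k) :
    H.normSqβ k β v ≤
      H.meshConst * (1 + Real.sqrt β * (H.h k ^ 2)⁻¹) * H.meshInner k v v := by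
  have h1 := H.l2Inner_self_le k (by omega) v
  have h2 := mul_le_mul_of_nonneg_left (H.gradInner_self_le k hd v) (Real.sqrt_nonneg β)
  rw [normSqβ]
  linarith

end MeshHierarchy

/-! ### Abstract facts on symmetric forms. -/

section Forms

variable {W : Type*} [AddCommGroup W] [Module ℝ W]

/-- Young's inequality for a semidefinite form, from its nonnegativity at v ± εw. -/
theorem two_mul_abs_form_le (b : LinearMap.BilinForm ℝ W) (hsymm : ∀ v w, b v w = b w v)
    (hnonneg : ∀ v, 0 ≤ b v v) {ε : ℝ} (hε : 0 < ε) (v w : W) :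
    2 * |b v w| ≤ ε⁻¹ * b v v + ε * b w w := by
  have h1 := hnonneg (v - ε • w)
  have h2 := hnonneg (v + ε • w)
  simp only [map_sub, map_add, map_smul, LinearMap.sub_apply, LinearMap.add_apply,
    LinearMap.smul_apply, smul_eq_mul, hsymm w v] at h1 h2
  have h3 : 2 * |b v w| * ε ≤ b v v + ε ^ 2 * b w w := by
    rcases abs_cases (b v w) with h | h <;> rw [h.1] <;> nlinarith
  have h4 : ε⁻¹ * b v v + ε * b w w = (b v v + ε ^ 2 * b w w) / ε := by field_simp
  rwa [h4, le_div_iff₀ hε]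

theorem form_inverse_symm (b : LinearMap.BilinForm ℝ W) {C : Module.End ℝ W} (hC : IsUnit C)
    (hsymm : ∀ v w, b (C v) w = b v (C w)) (v w : W) :
    b (Ring.inverse C v) w = b v (Ring.inverse C w) := by
  have h : ∀ x, C (Ring.inverse C x) = x := fun x =>
    LinearMap.congr_fun (Ring.mul_inverse_cancel C hC) x
  conv_lhs => rw [← h w]
  rw [← hsymm, h]

end Forms

/-! ### The operator 𝔅ℭ⁻¹𝔅: symmetry, spectral bound and smoothing. -/

namespace MeshHierarchy

variable {d : ℕ} {Ω : Set (Eu d)} (H : MeshHierarchy Ω) (k : ℕ)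

theorem l2Inner_symm (v w : H.V k) : H.l2Inner k v w = H.l2Inner k w v := by
  simp [l2Inner, mul_comm]

theorem gradInner_symm (v w : H.V k) : H.gradInner k v w = H.gradInner k w v := by
  simp only [gradInner, LinearMap.mk₂_apply, real_inner_comm]

theorem l2Inner_self_nonneg (v : H.V k) : 0 ≤ H.l2Inner k v v :=
  integral_nonneg fun _ => mul_self_nonneg _

theorem gradInner_self_nonneg (v : H.V k) : 0 ≤ H.gradInner k v v :=
  integral_nonneg fun _ => real_inner_self_nonneg

theorem eq_zero_of_l2Inner_self (hΩ : IsOpen Ω) (v : H.V k) (hv : H.l2Inner k v v = 0) :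
    v = 0 := by
  have h1 : (fun x => v.1 x * v.1 x) =ᵐ[volume.restrict Ω] 0 :=
    (integral_eq_zero_iff_of_nonneg (fun _ => mul_self_nonneg _) (H.integrable_mul k v v)).1 hv
  have h2 := Measure.eqOn_open_of_ae_eq h1 hΩ (v.2.1.mul v.2.1).continuousOn
    continuousOn_const
  apply Subtype.ext
  funext x
  by_cases hx : x ∈ Ω
  · exact mul_self_eq_zero.1 (h2 hx)
  · exact v.2.2.1 x hx

theorem pairInner_apply (u w : H.VV k) :
    H.pairInner k u w = H.meshInner k u.1 w.1 + H.meshInner k u.2 w.2 := rfl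

theorem pairInner_symm (u w : H.VV k) : H.pairInner k u w = H.pairInner k w u := by
  simp only [pairInner_apply, H.meshInner_symm k u.1, H.meshInner_symm k u.2]

theorem pairInner_self_nonneg (u : H.VV k) : 0 ≤ H.pairInner k u u :=
  add_nonneg (H.meshInner_self_nonneg k _) (H.meshInner_self_nonneg k _)

theorem formB_apply (β : ℝ) (u w : H.VV k) :
    H.formB k β u w = Real.sqrt β * H.gradInner k u.1 w.1 - H.l2Inner k u.2 w.1
      - H.l2Inner k u.1 w.2 - Real.sqrt β * H.gradInner k u.2 w.2 := rfl

theorem formB_symm (β : ℝ) (u w : H.VV k) : H.formB k β u w = H.formB k β w u := by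
  simp only [formB_apply, H.gradInner_symm k u.1, H.gradInner_symm k u.2, H.l2Inner_symm k u.1,
    H.l2Inner_symm k u.2]
  ring

/-- The square of the weighted norm on `V_k × V_k`. -/
def pairNormSqβ (β : ℝ) (u : H.VV k) : ℝ := H.normSqβ k β u.1 + H.normSqβ k β u.2

/-- Young's inequality on each of the four terms of ℬ. Every component of the two weighted norms is
used exactly once, so no extra constant appears. -/
theorem two_mul_formB_le (β : ℝ) {ε : ℝ} (hε : 0 < ε) (u w : H.VV k) :
    2 * H.formB k β u w ≤ ε⁻¹ * H.pairNormSqβ k β u + ε * H.pairNormSqβ k β w := by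
  have hβ := Real.sqrt_nonneg β
  have g := fun v w : H.V k => mul_le_mul_of_nonneg_left
    (two_mul_abs_form_le _ (H.gradInner_symm k) (H.gradInner_self_nonneg k) hε v w) hβ
  have l := two_mul_abs_form_le _ (H.l2Inner_symm k) (H.l2Inner_self_nonneg k) hε
  have g1 := g u.1 w.1
  have g2 := g u.2 w.2
  have l1 := l u.2 w.1
  have l2 := l u.1 w.2
  have a1 := mul_le_mul_of_nonneg_left (le_abs_self (H.gradInner k u.1 w.1)) hβ
  have a2 := mul_le_mul_of_nonneg_left (neg_abs_le (H.gradInner k u.2 w.2)) hβ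
  have a3 := neg_abs_le (H.l2Inner k u.2 w.1)
  have a4 := neg_abs_le (H.l2Inner k u.1 w.2)
  simp only [formB_apply, pairNormSqβ, normSqβ]
  linarith

theorem pairNormSqβ_le (hd : 2 ≤ d) (β : ℝ) (u : H.VV k) :
    H.pairNormSqβ k β u ≤
      H.meshConst * (1 + Real.sqrt β * (H.h k ^ 2)⁻¹) * H.pairInner k u u := by
  have h1 := H.normSqβ_le k hd β u.1
  have h2 := H.normSqβ_le k hd β u.2
  rw [pairNormSqβ, pairInner_apply]
  linarith

theorem opB_symm (β : ℝ) (u w : H.VV k) :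
    H.pairInner k (H.opB k β u) w = H.pairInner k u (H.opB k β w) := by
  rw [pairInner_opB, formB_symm, ← pairInner_opB, pairInner_symm]

variable (L : ℝ → (k : ℕ) → Module.End ℝ (H.V k)) (β : ℝ)

theorem pairInner_opC (u w : H.VV k) : H.pairInner k (H.opC k L β u) w =
    H.meshInner k (L β k u.1) w.1 + H.meshInner k (L β k u.2) w.2 := rfl

variable {L β}

theorem opC_symm (hL : H.IsPreconditioner L) (hβ : 0 < β) (u w : H.VV k) :
    H.pairInner k (H.opC k L β u) w = H.pairInner k u (H.opC k L β w) := by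
  rw [pairInner_opC, H.pairInner_symm k u, pairInner_opC, hL.symm β hβ, hL.symm β hβ,
    H.meshInner_symm k u.1, H.meshInner_symm k u.2]

theorem normSqβ_nonneg (v : H.V k) : 0 ≤ H.normSqβ k β v :=
  add_nonneg (H.l2Inner_self_nonneg k v)
    (mul_nonneg (Real.sqrt_nonneg β) (H.gradInner_self_nonneg k v))

/-- Coercivity of L gives injectivity, which suffices in finite dimension. Without invertibility
`Ring.inverse` would be 0. -/
theorem isUnit_opC (hΩ : IsOpen Ω) (hL : H.IsPreconditioner L) (hβ : 0 < β) :
    IsUnit (H.opC k L β) := by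
  obtain ⟨c₁, hc₁, c₂, -, hc⟩ := hL.equiv
  have hinj : ∀ v, L β k v = 0 → v = 0 := fun v hv => by
    refine H.eq_zero_of_l2Inner_self k hΩ v (le_antisymm ?_ (H.l2Inner_self_nonneg k v))
    have h := (hc β hβ k v).1
    rw [hv, map_zero, LinearMap.zero_apply] at h
    have h1 := nonpos_of_mul_nonpos_right h hc₁
    have h2 := mul_nonneg (Real.sqrt_nonneg β) (H.gradInner_self_nonneg k v)
    rw [normSqβ] at h1
    linarith
  refine (LinearMap.isUnit_iff_ker_eq_bot _).2 ((LinearMap.ker_eq_bot').2 fun u hu => ?_)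
  exact Prod.ext (hinj _ (congrArg Prod.fst hu)) (hinj _ (congrArg Prod.snd hu))

theorem opA_symm (hΩ : IsOpen Ω) (hL : H.IsPreconditioner L) (hβ : 0 < β) (u w : H.VV k) :
    H.pairInner k (H.opA k L β u) w = H.pairInner k u (H.opA k L β w) := by
  simp only [opA, Module.End.mul_apply]
  rw [opB_symm, form_inverse_symm _ (H.isUnit_opC k hΩ hL hβ) (H.opC_symm k hL hβ), opB_symm]

/-- With `w = ℭ_k⁻¹ 𝔅_k u`, the energy of `𝔅_k ℭ_k⁻¹ 𝔅_k` at `u` is the energy of `ℭ_k` at `w`. -/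
theorem exists_pairInner_opA_self (hΩ : IsOpen Ω) (hL : H.IsPreconditioner L) (hβ : 0 < β)
    (u : H.VV k) : ∃ w, H.pairInner k (H.opA k L β u) u = H.formB k β u w ∧
      H.formB k β u w = H.pairInner k (H.opC k L β w) w := by
  refine ⟨Ring.inverse (H.opC k L β) (H.opB k β u), ?_, ?_⟩
  · simp only [opA, Module.End.mul_apply]
    rw [pairInner_opB, formB_symm]
  · rw [← pairInner_opB]
    congr 2
    exact (LinearMap.congr_fun (Ring.mul_inverse_cancel _ (H.isUnit_opC k hΩ hL hβ)) _).symm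

theorem le_pairInner_opC_self {c₁ : ℝ}
    (hc : ∀ v, c₁ * H.normSqβ k β v ≤ H.meshInner k (L β k v) v) (u : H.VV k) :
    c₁ * H.pairNormSqβ k β u ≤ H.pairInner k (H.opC k L β u) u := by
  have h1 := hc u.1
  have h2 := hc u.2
  rw [pairInner_opC, pairNormSqβ]
  linarith

theorem pairInner_opA_self_nonneg (hΩ : IsOpen Ω) (hL : H.IsPreconditioner L) (hβ : 0 < β)
    (u : H.VV k) : 0 ≤ H.pairInner k (H.opA k L β u) u := by
  obtain ⟨c₁, hc₁, c₂, -, hc⟩ := hL.equiv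
  obtain ⟨w, h1, h2⟩ := H.exists_pairInner_opA_self k hΩ hL hβ u
  rw [h1, h2]
  exact (mul_nonneg hc₁.le (add_nonneg (H.normSqβ_nonneg k _) (H.normSqβ_nonneg k _))).trans
    (H.le_pairInner_opC_self k (fun v => (hc β hβ k v).1) w)

/-- Young's inequality with ε = c₁ makes the w-term at most [ℭw, w], which equals ℬ(u, w) itself and
is absorbed on the left. -/
theorem pairInner_opA_self_le (hΩ : IsOpen Ω) (hL : H.IsPreconditioner L) (hβ : 0 < β)
    {c₁ : ℝ} (hc₁ : 0 < c₁) (hc : ∀ v, c₁ * H.normSqβ k β v ≤ H.meshInner k (L β k v) v)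
    (u : H.VV k) : H.pairInner k (H.opA k L β u) u ≤ c₁⁻¹ * H.pairNormSqβ k β u := by
  obtain ⟨w, h1, h2⟩ := H.exists_pairInner_opA_self k hΩ hL hβ u
  have h3 := H.two_mul_formB_le k β hc₁ u w
  have h4 := H.le_pairInner_opC_self k hc w
  rw [h1]
  linarith

theorem exists_isMaxEigenvalueConstant (hd : 2 ≤ d) (hΩ : IsOpen Ω)
    (hL : H.IsPreconditioner L) : ∃ C : ℝ, H.IsMaxEigenvalueConstant L C := by
  obtain ⟨c₁, hc₁, c₂, -, hc⟩ := hL.equiv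
  have hm := H.meshConst_pos
  refine ⟨c₁⁻¹ * H.meshConst, by positivity, fun β hβ k => ?_⟩
  have hh := H.h_pos k
  refine lamMax_le (H.pairInner k) (H.pairInner_self_nonneg k) (H.pairInner_self_eq_zero k) _
    (by positivity) fun u => ?_
  refine (H.pairInner_opA_self_le k hΩ hL hβ hc₁ (fun v => (hc β hβ k v).1) u).trans ?_
  have := mul_le_mul_of_nonneg_left (H.pairNormSqβ_le k hd β u) (inv_nonneg.2 hc₁.le)
  linarith

/-- The smoothing property for the fine meshes. -/
theorem triNorm_opR_pow_le (hΩ : IsOpen Ω) (hL : H.IsPreconditioner L) {Cmax Cdag : ℝ}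
    (hC : H.IsMaxEigenvalueConstant L Cmax) (hdag : Cmax ≤ Cdag) (hβ : 0 < β)
    (hk : 1 ≤ Real.sqrt β * (H.h k ^ 2)⁻¹) {s : ℝ} (hs0 : 0 ≤ s) (hs1 : s ≤ 1) {m : ℕ}
    (hm : 1 ≤ m) (u : H.VV k) :
    H.triNorm k L β 1 ((H.opR k L β Cdag ^ m) u) ≤
      max 1 Cdag * (1 + Real.sqrt β * (H.h k ^ 2)⁻¹) ^ (s / 2) * (m : ℝ) ^ (-s / 2) *
        H.triNorm k L β (1 - s) u := by
  set ρ := 1 + Real.sqrt β * (H.h k ^ 2)⁻¹ with hρ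
  have hρ0 : 0 < ρ := by linarith
  have hD : 0 < Cdag := hC.1.trans_le hdag
  have hdamp : H.damping k L β Cdag = (Cdag * ρ)⁻¹ := by
    rw [damping, if_neg (not_lt.2 hk)]
  have h1 : (Cdag * ρ)⁻¹ * lamMax (H.opA k L β) ≤ 1 := by
    rw [inv_mul_le_iff₀ (by positivity), mul_one]
    exact (hC.2 β hβ k).trans (mul_le_mul_of_nonneg_right hdag hρ0.le)
  have h := sqrt_fracPow_richardson_le (H.pairInner k) (H.pairInner_symm k)
    (H.pairInner_self_nonneg k) (H.pairInner_self_eq_zero k) _ (H.opA_symm k hΩ hL hβ)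
    (H.pairInner_opA_self_nonneg k hΩ hL hβ) (by positivity) h1 hs0 hs1 hm u
  rw [opR, hdamp]
  refine h.trans ?_
  rw [inv_inv, Real.mul_rpow hD.le hρ0.le]
  -- Enlarging the base to at least 1 makes the power monotone in the exponent; since s / 2 ≤ 1, the
  -- constant is uniform in s.
  have hle : Cdag ^ (s / 2) ≤ max 1 Cdag :=
    calc Cdag ^ (s / 2) ≤ max 1 Cdag ^ (s / 2) :=
          Real.rpow_le_rpow hD.le (le_max_right _ _) (by linarith)
      _ ≤ max 1 Cdag ^ (1 : ℝ) :=
          Real.rpow_le_rpow_of_exponent_le (le_max_left _ _) (by linarith)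
      _ = max 1 Cdag := Real.rpow_one _
  unfold triNorm
  gcongr

end MeshHierarchy

end KKT

end

theorem mainTheorem7 {d : ℕ} (hd : d = 2 ∨ d = 3) (Ω : Set (KKT.Eu d))
    (hΩ : KKT.IsBoundedConvexDomain Ω) (H : KKT.MeshHierarchy Ω)
    (L : ℝ → (k : ℕ) → Module.End ℝ (H.V k)) (hL : H.IsPreconditioner L) :
    (∃ Cmax : ℝ, H.IsMaxEigenvalueConstant L Cmax) ∧
    ∀ Cmax : ℝ, H.IsMaxEigenvalueConstant L Cmax → ∀ Cdag : ℝ, Cmax ≤ Cdag →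
      ∃ C : ℝ, 0 < C ∧ ∀ β : ℝ, 0 < β → ∀ k : ℕ, 1 ≤ Real.sqrt β * (H.h k ^ 2)⁻¹ →
        ∀ s : ℝ, 0 ≤ s → s ≤ 1 → ∀ m : ℕ, 1 ≤ m → ∀ u : H.VV k,
          H.triNorm k L β 1 ((H.opR k L β Cdag ^ m) u) ≤
            C * (1 + Real.sqrt β * (H.h k ^ 2)⁻¹) ^ (s / 2) * (m : ℝ) ^ (-s / 2) *
              H.triNorm k L β (1 - s) u := by
  have hd2 : 2 ≤ d := by omega
  refine ⟨H.exists_isMaxEigenvalueConstant hd2 hΩ.isOpen hL, fun Cmax hC Cdag hdag => ?_⟩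
  exact ⟨max 1 Cdag, lt_max_of_lt_left one_pos, fun β hβ k hk s hs0 hs1 m hm u =>
    H.triNorm_opR_pow_le k hΩ.isOpen hL hC hdag hβ hk hs0 hs1 hm u⟩
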